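/- Let $\Pi=\{s\in\mathbb C:\operatorname{Re}s>0\}$ and, for a set $G\subset\mathbb C$, let $\widetilde G$ denote its convex hull. For a domain (non-empty connected open set) $G\subset\mathbb C$ with $\widetilde G\neq\mathbb C$, let $S(G)$ be the set of all real $\sigma\ge 0$ such that $$\sum_{n=2}^{\infty}\frac{|a_n|}{n^{\sigma}}<\operatorname{dist}(a_1,\partial\widetilde G)$$ (in particular the series converges) for every bounded holomorphic function $f$ on $\Pi$ with $f(\Pi)\subset G$ which is the sum of an ordinary Dirichlet series $f(s)=\sum_{n=1}^{\infty}a_n n^{-s}$ converging (not necessarily absolutely) at every $s\in\Pi$. The isometric Bohr abscissa of $G$ is $\mathbf b(G)=\inf S(G)$. A point $p\in\partial G$ is a point of convexity if $p\in\partial\widetilde G$; it is regular if moreover there is an open disc $U\subset G$ (of positive radius) with $p\in\partial U$. Let $U_1=\{z\in\mathbb C:|z|<1\}$. Theorem 2.1. Let $G$ be a bounded domain in $\mathbb C$. Then $S(G)\neq\emptyset$, so that $\mathbf b(G)$ is a well-defined non-negative real number, and $\mathbf b(G)\le\mathbf b(U_1)$. If $\partial G$ contains at least one regular point of convexity, then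 $\mathbf b(G)=\mathbf b(U_1)$. -/

import Mathlib

open Set Filter Topology

noncomputable section

/-- The open right half-plane `Π = {s : Re s > 0}`. -/
def rightHalfPlane : Set ℂ := {s : ℂ | 0 < s.re}

/-- `f` belongs to `H^∞(Π)` (bounded and holomorphic on the right half-plane) and at every point
of `Π` it is the sum of the ordinary Dirichlet series `∑_{n ≥ 1} a n / n ^ s`. Convergence is that
of the partial sums, not absolute convergence; the value `a 0` plays no role. -/
structure IsHInftyDirichlet (f : ℂ → ℂ) (a : ℕ → ℂ) : Prop where
  differentiableOn : DifferentiableOn ℂ f rightHalfPlane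
  bounded : ∃ C : ℝ, ∀ s ∈ rightHalfPlane, ‖f s‖ ≤ C
  tendsto : ∀ s ∈ rightHalfPlane,
    Tendsto (fun N : ℕ => ∑ n ∈ Finset.Icc 1 N, a n / (n : ℂ) ^ s) atTop (𝓝 (f s))

/-- The `σ ≥ 0` such that `∑_{n ≥ 2} |a n| / n ^ σ` converges and is less than
`dist (a 1, ∂ (conv G))` for every `f ∈ H^∞(Π)` that is the sum of a Dirichlet series with
coefficients `a` in `Π` and has `f(Π) ⊆ G`. -/
def bohrAdmissible (G : Set ℂ) : Set ℝ :=
  {σ : ℝ | 0 ≤ σ ∧ ∀ (f : ℂ → ℂ) (a : ℕ → ℂ), IsHInftyDirichlet f a → MapsTo f rightHalfPlane G →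
    Summable (fun n : ℕ => ‖a (n + 2)‖ / ((n + 2 : ℕ) : ℝ) ^ σ) ∧
    ∑' n : ℕ, ‖a (n + 2)‖ / ((n + 2 : ℕ) : ℝ) ^ σ <
      Metric.infDist (a 1) (frontier (convexHull ℝ G))}

/-- The isometric Bohr abscissa `b(G)`, for a domain `G` whose convex hull is not all of `ℂ`. -/
def isometricBohrAbscissa (G : Set ℂ) : ℝ := sInf (bohrAdmissible G)

/-- A boundary point of `G` that is also a boundary point of the convex hull of `G`. -/
def IsPointOfConvexity (G : Set ℂ) (p : ℂ) : Prop :=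
  p ∈ frontier G ∧ p ∈ frontier (convexHull ℝ G)

/-- A point of convexity that lies on the boundary circle of some open disc contained in `G`. -/
def IsRegularPointOfConvexity (G : Set ℂ) (p : ℂ) : Prop :=
  IsPointOfConvexity G p ∧
    ∃ (c : ℂ) (r : ℝ), 0 < r ∧ Metric.ball c r ⊆ G ∧ p ∈ frontier (Metric.ball c r)

end

/-!
The isometric Bohr abscissa of a bounded domain is controlled by a single linear extremal problem,
the one for functions of positive real part. Call `σ` good (`PositiveRealPartBound σ`) if
`∑_{n ≥ 2} |b n| n ^ (-σ) ≤ |b 1|` for all `g = ∑ b n n ^ (-s)` in `H^∞(Π)` with `Re g > 0`.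

* If `σ` is good, then every `τ > σ` is admissible for every bounded domain `G`
  (`PositiveRealPartBound.mem_bohrAdmissible`). Let `p` be a point of the boundary of the convex
  hull nearest to `a 1` and `{z | Re (w (p - z)) > 0}` a supporting half-plane there. Then
  `g = w (p - f)` has positive real part, and its first coefficient has modulus
  `|w| |p - a 1| = |w| dist (a 1, ∂ (conv G))`. Raising the exponent from `σ` to `τ` makes the
  inequality strict.
* If `G` has a regular point of convexity `p`, then every admissible `σ` is good
  (`positiveRealPartBound_of_mem_bohrAdmissible`). Seen from very close to `p`, a disc in `G` that
  touches `p` is a half-plane: if `g` is bounded and `Re g > 0`, then `p - ε (p - c) (g + δ)` takes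
  values in the disc of centre `c` through `p` as soon as `ε` is small compared with `δ`. The
  distance of its first coefficient to the boundary of the hull is at most its distance to `p`.

Hence `b(G') ≤ b(G)` whenever `G` has a regular point of convexity (`isometricBohrAbscissa_le`), and
the unit disc has one. Good exponents exist (`positiveRealPartBound_seven`) because a function of
positive real part with an absolutely convergent Dirichlet series has coefficients bounded by
twice the first one, by a mean value argument (`norm_coeff_le_of_re_nonneg`).
-/

/-! ### Mean values of series of exponentials -/

theorem tendsto_mean_exp (l : ℝ) :
    Tendsto (fun T : ℝ => (T : ℂ)⁻¹ * ∫ t in (0 : ℝ)..T, Complex.exp (l * Complex.I * t)) atTop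
      (𝓝 (if l = 0 then 1 else 0)) := by
  split_ifs with hl
  · refine tendsto_const_nhds.congr' ?_
    filter_upwards [eventually_gt_atTop 0] with T hT
    have : (T : ℂ) ≠ 0 := by exact_mod_cast hT.ne'
    simp [hl, this]
  · have hc : (l * Complex.I : ℂ) ≠ 0 := by simp [hl]
    have hb : Tendsto (fun T : ℝ => T⁻¹ * (2 / |l|)) atTop (𝓝 0) := by
      simpa using tendsto_inv_atTop_zero.mul_const (2 / |l|)
    refine squeeze_zero_norm' ?_ hb
    filter_upwards [eventually_gt_atTop 0] with T hT
    rw [integral_exp_mul_complex hc, norm_mul, norm_div, norm_inv, Complex.norm_real,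
      Real.norm_of_nonneg hT.le]
    have h1 : ‖Complex.exp (l * Complex.I * T)‖ = 1 := by
      rw [Complex.norm_exp]; simp
    have h2 : ‖(l * Complex.I : ℂ)‖ = |l| := by simp
    rw [h2]
    gcongr
    refine (norm_sub_le _ _).trans ?_
    rw [h1]; norm_num

theorem norm_mean_exp_le (l : ℝ) {T : ℝ} (hT : 0 < T) :
    ‖(T : ℂ)⁻¹ * ∫ t in (0 : ℝ)..T, Complex.exp (l * Complex.I * t)‖ ≤ 1 := by
  have h : ‖∫ t in (0 : ℝ)..T, Complex.exp (l * Complex.I * t)‖ ≤ 1 * |T - 0| := by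
    refine intervalIntegral.norm_integral_le_of_norm_le_const fun t _ => ?_
    rw [Complex.norm_exp]; simp
  rw [norm_mul, norm_inv, Complex.norm_real, Real.norm_of_nonneg hT.le, inv_mul_le_iff₀ hT]
  simpa [abs_of_pos hT] using h

/-- The mean value of an absolutely convergent series of exponentials is the sum of its terms of
frequency `0`. -/
theorem tendsto_mean_of_hasSum {ι : Type*} [Countable ι] {c : ι → ℂ}
    (hc : Summable fun k => ‖c k‖) (l : ι → ℝ) {h : ℝ → ℂ}
    (hh : ∀ t : ℝ, HasSum (fun k => c k * Complex.exp (l k * Complex.I * t)) (h t)) {L : ℂ}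
    (hL : HasSum (fun k => if l k = 0 then c k else 0) L) :
    Tendsto (fun T : ℝ => (T : ℂ)⁻¹ * ∫ t in (0 : ℝ)..T, h t) atTop (𝓝 L) := by
  have hsum : ∀ T : ℝ, HasSum
      (fun k => c k * ∫ t in (0 : ℝ)..T, Complex.exp (l k * Complex.I * t))
      (∫ t in (0 : ℝ)..T, h t) := by
    intro T
    simp only [← intervalIntegral.integral_const_mul]
    refine intervalIntegral.hasSum_integral_of_dominated_convergence (fun k _ => ‖c k‖)
      (fun k => ?_) (fun k => ?_) ?_ ?_ ?_
    · exact Continuous.aestronglyMeasurable (by fun_prop)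
    · refine Eventually.of_forall fun t _ => ?_
      rw [norm_mul, Complex.norm_exp]; simp
    · exact Eventually.of_forall fun _ _ => hc
    · exact intervalIntegrable_const
    · exact Eventually.of_forall fun t _ => hh t
  have h2 := tendsto_tsum_of_dominated_convergence (𝓕 := (atTop : Filter ℝ))
    (f := fun T k => c k * ((T : ℂ)⁻¹ * ∫ t in (0 : ℝ)..T, Complex.exp (l k * Complex.I * t)))
    (g := fun k => c k * if l k = 0 then 1 else 0) hc
    (fun k => (tendsto_mean_exp (l k)).const_mul (c k)) (by
      filter_upwards [eventually_gt_atTop 0] with T hT k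
      rw [norm_mul]
      exact mul_le_of_le_one_right (norm_nonneg _) (norm_mean_exp_le (l k) hT))
  simp only [mul_ite, mul_one, mul_zero, hL.tsum_eq] at h2
  refine h2.congr fun T => ?_
  rw [← (hsum T).tsum_eq, ← tsum_mul_left]
  exact tsum_congr fun k => by ring

/-- The coefficients of an absolutely convergent general Dirichlet series with non-negative real
part are at most twice the constant one. The conjugate series has only frequencies `≤ 0`, so for
`N ≠ 0` the mean of `2 Re h` twisted by the `N`-th exponential is `c N`, and it is dominated by the
mean of `2 Re h`. -/
theorem norm_coeff_le_of_re_nonneg {c : ℕ → ℂ} (hc : Summable fun k => ‖c k‖) {l : ℕ → ℝ}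
    (hl : StrictMono l) (hl0 : l 0 = 0) {h : ℝ → ℂ}
    (hh : ∀ t : ℝ, HasSum (fun k => c k * Complex.exp (l k * Complex.I * t)) (h t))
    (hre : ∀ t, 0 ≤ (h t).re) {N : ℕ} (hN : N ≠ 0) : ‖c N‖ ≤ 2 * ‖c 0‖ := by
  have hpos : ∀ k, 0 ≤ l k := fun k => hl0 ▸ hl.monotone (Nat.zero_le k)
  have hlN : 0 < l N := hl0 ▸ hl (Nat.pos_of_ne_zero hN)
  -- `2 Re h = h + conj h` as one series of exponentials, indexed by two copies of `ℕ`.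
  let d : ℕ ⊕ ℕ → ℂ := Sum.elim c (fun k => starRingEnd ℂ (c k))
  let m : ℕ ⊕ ℕ → ℝ := Sum.elim l (fun k => -l k)
  have hd : Summable fun k => ‖d k‖ := by
    refine Summable.sum _ hc ?_
    simpa [d, Function.comp_def] using hc
  have hsum : ∀ t : ℝ, HasSum (fun k => d k * Complex.exp (m k * Complex.I * t))
      (((2 * (h t).re : ℝ) : ℂ)) := by
    intro t
    rw [← Complex.add_conj]
    refine HasSum.sum (hh t) ?_
    have h1 := Complex.hasSum_conj'.2 (hh t)
    convert h1 using 2 with k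
    simp [d, m, ← Complex.exp_conj]
  -- The mean of `2 Re h` itself picks out the two terms of frequency `0`.
  have hmean0 := tendsto_mean_of_hasSum hd m hsum (L := c 0 + starRingEnd ℂ (c 0)) (by
    refine HasSum.sum ?_ ?_
    · convert hasSum_ite_eq 0 (c 0) using 2 with k
      by_cases hk : k = 0
      · simp [m, d, hk, hl0]
      · have : l k ≠ 0 := fun h0 => hk (hl.injective (h0.trans hl0.symm))
        simp [m, hk, this]
    · convert hasSum_ite_eq 0 (starRingEnd ℂ (c 0)) using 2 with k
      by_cases hk : k = 0
      · simp [m, d, hk, hl0]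
      · have : l k ≠ 0 := fun h0 => hk (hl.injective (h0.trans hl0.symm))
        simp [m, hk, this])
  -- Twisting by `exp (-i l_N t)` isolates `c N`; conjugate terms have frequency `-l_k - l_N < 0`.
  have hmeanN := tendsto_mean_of_hasSum hd (fun k => m k - l N)
    (h := fun t => ((2 * (h t).re : ℝ) : ℂ) * Complex.exp (-(l N * Complex.I * t))) (fun t => by
      have h1 := (hsum t).mul_right (Complex.exp (-(l N * Complex.I * t)))
      have h2 : ∀ k, d k * Complex.exp (((m k - l N : ℝ) : ℂ) * Complex.I * t) =
          d k * Complex.exp (m k * Complex.I * t) * Complex.exp (-(l N * Complex.I * t)) := by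
        intro k
        rw [mul_assoc (d k), ← Complex.exp_add]
        congr 2
        push_cast
        ring
      simpa only [h2] using h1) (L := c N + 0) (by
    refine HasSum.sum ?_ ?_
    · convert hasSum_ite_eq N (c N) using 2 with k
      by_cases hk : k = N
      · simp [m, d, hk]
      · have : l k - l N ≠ 0 := fun h0 => hk (hl.injective (sub_eq_zero.1 h0))
        simp [m, hk, this]
    · convert hasSum_zero using 2 with k
      have : -l k - l N ≠ 0 := by linarith [hpos k]
      simp [m, this])
  have hle : ‖c N + 0‖ ≤ ‖c 0 + starRingEnd ℂ (c 0)‖ := by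
    refine le_of_tendsto_of_tendsto hmeanN.norm hmean0.norm ?_
    filter_upwards [eventually_gt_atTop 0] with T hT
    rw [norm_mul, norm_mul]
    gcongr
    rw [intervalIntegral.integral_ofReal, Complex.norm_real]
    refine (intervalIntegral.norm_integral_le_integral_norm hT.le).trans ?_
    refine le_of_eq_of_le ?_ (le_abs_self _)
    refine intervalIntegral.integral_congr fun t _ => ?_
    simp [Complex.norm_exp, abs_of_nonneg (hre t)]
  calc ‖c N‖ ≤ ‖c 0 + starRingEnd ℂ (c 0)‖ := by simpa using hle
    _ ≤ ‖c 0‖ + ‖starRingEnd ℂ (c 0)‖ := norm_add_le _ _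
    _ = 2 * ‖c 0‖ := by rw [RCLike.norm_conj]; ring

/-! ### Dirichlet series in the right half-plane -/

theorem IsHInftyDirichlet.const_add_mul {f : ℂ → ℂ} {a : ℕ → ℂ} (h : IsHInftyDirichlet f a)
    (α β : ℂ) :
    IsHInftyDirichlet (fun s => α + β * f s) (fun n => (if n = 1 then α else 0) + β * a n) where
  differentiableOn := (h.differentiableOn.const_mul β).const_add α
  bounded := by
    obtain ⟨C, hC⟩ := h.bounded
    refine ⟨‖α‖ + ‖β‖ * C, fun s hs => (norm_add_le _ _).trans ?_⟩
    rw [norm_mul]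
    gcongr
    exact hC s hs
  tendsto s hs := by
    refine (((h.tendsto s hs).const_mul β).const_add α).congr' ?_
    filter_upwards [eventually_ge_atTop 1] with N hN
    simp only [add_div, Finset.sum_add_distrib, Finset.mul_sum, ite_div, zero_div,
      Finset.sum_ite_eq', Finset.mem_Icc, le_refl, true_and, hN, if_true, mul_div_assoc]
    simp

/-- Convergence at `s = 1` alone makes the coefficients grow at most linearly. -/
theorem IsHInftyDirichlet.exists_norm_le {f : ℂ → ℂ} {a : ℕ → ℂ} (h : IsHInftyDirichlet f a) :
    ∃ C : ℝ, ∀ n : ℕ, ‖a (n + 1)‖ ≤ C * ((n + 1 : ℕ) : ℝ) := by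
  have h1 := h.tendsto 1 (by simp [rightHalfPlane])
  obtain ⟨C, hC⟩ := h1.norm.bddAbove_range
  refine ⟨C + C, fun n => ?_⟩
  have hn : (0 : ℝ) < ((n + 1 : ℕ) : ℝ) := by positivity
  have h3 : ‖a (n + 1) / ((n + 1 : ℕ) : ℂ) ^ (1 : ℂ)‖ ≤ C + C := by
    rw [← add_sub_cancel_left (∑ k ∈ Finset.Icc 1 n, a k / (k : ℂ) ^ (1 : ℂ))
      (a (n + 1) / ((n + 1 : ℕ) : ℂ) ^ (1 : ℂ)), ← Finset.sum_Icc_succ_top (by omega)]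
    exact (norm_sub_le _ _).trans (add_le_add (hC ⟨n + 1, rfl⟩) (hC ⟨n, rfl⟩))
  rwa [Complex.cpow_one, norm_div, Complex.norm_natCast, div_le_iff₀ hn] at h3

theorem IsHInftyDirichlet.summable_norm_div_pow_three {f : ℂ → ℂ} {a : ℕ → ℂ}
    (h : IsHInftyDirichlet f a) : Summable fun n : ℕ => ‖a (n + 1) / ((n + 1 : ℕ) : ℂ) ^ 3‖ := by
  obtain ⟨C, hC⟩ := h.exists_norm_le
  have h2 : Summable fun n : ℕ => C * (1 / ((n + 1 : ℕ) : ℝ) ^ 2) :=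
    ((summable_nat_add_iff 1).2 (Real.summable_one_div_nat_pow.2 one_lt_two)).mul_left C
  refine h2.of_nonneg_of_le (fun _ => norm_nonneg _) fun n => ?_
  have hn : (0 : ℝ) < ((n + 1 : ℕ) : ℝ) := by positivity
  rw [norm_div, norm_pow, Complex.norm_natCast]
  refine (div_le_div_of_nonneg_right (hC n) (by positivity)).trans_eq ?_
  field_simp

/-- The Dirichlet series on the line `Re s = 3`, where it converges absolutely, written as a series
of exponentials with frequencies `log (n + 1)`. The line is run through downwards so that the
frequencies are non-negative. -/
theorem IsHInftyDirichlet.hasSum_vertical {f : ℂ → ℂ} {a : ℕ → ℂ} (h : IsHInftyDirichlet f a)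
    (t : ℝ) :
    HasSum (fun n : ℕ => a (n + 1) / ((n + 1 : ℕ) : ℂ) ^ 3 *
      Complex.exp ((Real.log ((n + 1 : ℕ) : ℝ) : ℝ) * Complex.I * t)) (f (3 - t * Complex.I)) := by
  have hterm : ∀ n : ℕ, a (n + 1) / ((n + 1 : ℕ) : ℂ) ^ 3 *
      Complex.exp ((Real.log ((n + 1 : ℕ) : ℝ) : ℝ) * Complex.I * t) =
      a (n + 1) / ((n + 1 : ℕ) : ℂ) ^ (3 - t * Complex.I : ℂ) := by
    intro n
    have hn : ((n + 1 : ℕ) : ℂ) ≠ 0 := by exact_mod_cast Nat.succ_ne_zero n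
    have e : Complex.exp ((Real.log ((n + 1 : ℕ) : ℝ) : ℝ) * Complex.I * t) =
        ((n + 1 : ℕ) : ℂ) ^ (t * Complex.I : ℂ) := by
      rw [Complex.cpow_def_of_ne_zero hn, Complex.ofReal_log (by positivity),
        Complex.ofReal_natCast]
      congr 1
      ring
    rw [e, Complex.cpow_sub _ _ hn]
    norm_cast
    field_simp
  have hs : Summable fun n : ℕ => a (n + 1) / ((n + 1 : ℕ) : ℂ) ^ 3 *
      Complex.exp ((Real.log ((n + 1 : ℕ) : ℝ) : ℝ) * Complex.I * t) := by
    refine Summable.of_norm ?_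
    refine h.summable_norm_div_pow_three.congr fun n => ?_
    rw [norm_mul, Complex.norm_exp]
    simp
  have hlim := h.tendsto (3 - t * Complex.I) (by simp [rightHalfPlane])
  have h2 := hs.hasSum.tendsto_sum_nat
  have heq : (fun N : ℕ => ∑ n ∈ Finset.range N, a (n + 1) / ((n + 1 : ℕ) : ℂ) ^ 3 *
      Complex.exp ((Real.log ((n + 1 : ℕ) : ℝ) : ℝ) * Complex.I * t)) =
      fun N : ℕ => ∑ n ∈ Finset.Icc 1 N, a n / (n : ℂ) ^ (3 - t * Complex.I : ℂ) := by
    funext N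
    simp only [hterm]
    rw [Finset.range_eq_Ico,
      Finset.sum_Ico_add' (fun n : ℕ => a n / (n : ℂ) ^ (3 - t * Complex.I : ℂ)) 0 N 1]
    rfl
  rw [heq] at h2
  rw [tendsto_nhds_unique hlim h2]
  exact hs.hasSum

/-! ### The extremal problem for positive real part -/

/-- `σ` bounds the coefficients of Dirichlet series of positive real part: for each
`g = ∑ b n / n ^ s` in `H^∞(Π)` with `Re g > 0` on `Π`, the sum of `|b n| / n ^ σ` over `n ≥ 2`
converges and is at most `|b 1|`. -/
def PositiveRealPartBound (σ : ℝ) : Prop :=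
  ∀ (g : ℂ → ℂ) (b : ℕ → ℂ), IsHInftyDirichlet g b → (∀ s ∈ rightHalfPlane, 0 < (g s).re) →
    Summable (fun n : ℕ => ‖b (n + 2)‖ / ((n + 2 : ℕ) : ℝ) ^ σ) ∧
    ∑' n : ℕ, ‖b (n + 2)‖ / ((n + 2 : ℕ) : ℝ) ^ σ ≤ ‖b 1‖

/-- On the line `Re s = 3` the coefficient bound reads `|b n| n ^ (-3) ≤ 2 |b 1|`, and
`2 ∑_{n ≥ 2} n ^ (3 - 7) = 2 (π ^ 4 / 90 - 1) ≤ 1`. -/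
theorem positiveRealPartBound_seven : PositiveRealPartBound 7 := by
  intro g b hg hpos
  have hcoeff : ∀ n : ℕ, ‖b (n + 2)‖ ≤ 2 * ‖b 1‖ * ((n + 2 : ℕ) : ℝ) ^ 3 := by
    intro n
    have h := norm_coeff_le_of_re_nonneg hg.summable_norm_div_pow_three
      (l := fun n => Real.log ((n + 1 : ℕ) : ℝ))
      (fun m n hmn => Real.log_lt_log (by positivity) (by exact_mod_cast Nat.succ_lt_succ hmn))
      (by simp) hg.hasSum_vertical (fun t => (hpos _ (by simp [rightHalfPlane])).le)
      (Nat.succ_ne_zero n)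
    rw [norm_div, norm_pow, Complex.norm_natCast, div_le_iff₀ (by positivity)] at h
    simpa [add_assoc, one_add_one_eq_two] using h
  have hterm : ∀ n : ℕ, ‖b (n + 2)‖ / ((n + 2 : ℕ) : ℝ) ^ (7 : ℝ) ≤
      2 * ‖b 1‖ * (1 / ((n + 2 : ℕ) : ℝ) ^ 4) := by
    intro n
    have h7 : ((n + 2 : ℕ) : ℝ) ^ (7 : ℝ) = ((n + 2 : ℕ) : ℝ) ^ 7 := by
      exact_mod_cast Real.rpow_natCast ((n + 2 : ℕ) : ℝ) 7
    rw [h7]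
    have hn : (0 : ℝ) < ((n + 2 : ℕ) : ℝ) := by positivity
    refine (div_le_div_of_nonneg_right (hcoeff n) (by positivity)).trans_eq ?_
    field_simp
  have hz : HasSum (fun n : ℕ => 1 / ((n + 2 : ℕ) : ℝ) ^ 4) (Real.pi ^ 4 / 90 - 1) := by
    simpa [Finset.sum_range_succ] using (hasSum_nat_add_iff' 2).2 hasSum_zeta_four
  have hπ : 2 * (Real.pi ^ 4 / 90 - 1) ≤ 1 := by
    have : Real.pi ^ 4 ≤ 3.15 ^ 4 := by gcongr; exact Real.pi_lt_d2.le
    norm_num at this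
    linarith
  have hz' := hz.mul_left (2 * ‖b 1‖)
  have hs := hz'.summable.of_nonneg_of_le (fun n => by positivity) hterm
  refine ⟨hs, (hs.tsum_le_tsum hterm hz'.summable).trans ?_⟩
  rw [hz'.tsum_eq]
  nlinarith [norm_nonneg (b 1)]

/-- A disc in `G` touching the boundary of the convex hull at `p` contains
`p - ε (p - c) (g + δ)` for small `ε`, for any bounded `g` with positive real part; the inequality
defining admissibility is homogeneous in `ε`, and `δ → 0` gives the bound for `g`. -/
theorem positiveRealPartBound_of_mem_bohrAdmissible {G : Set ℂ} {p : ℂ}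
    (hp : IsRegularPointOfConvexity G p) {σ : ℝ} (hσ : σ ∈ bohrAdmissible G) :
    PositiveRealPartBound σ := by
  obtain ⟨⟨-, hpK⟩, c, r, hr, hball, hpc⟩ := hp
  rw [frontier_ball c hr.ne', mem_sphere_iff_norm] at hpc
  intro g b hg hpos
  have key : ∀ δ : ℝ, 0 < δ → Summable (fun n : ℕ => ‖b (n + 2)‖ / ((n + 2 : ℕ) : ℝ) ^ σ) ∧
      ∑' n : ℕ, ‖b (n + 2)‖ / ((n + 2 : ℕ) : ℝ) ^ σ ≤ ‖b 1‖ + δ := by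
    intro δ hδ
    obtain ⟨C, hC⟩ := hg.bounded
    have hC0 : 0 ≤ C := (norm_nonneg _).trans (hC 1 (by simp [rightHalfPlane]))
    obtain ⟨ε, hε, hεC⟩ : ∃ ε : ℝ, 0 < ε ∧ ε * (C + δ) ^ 2 < 2 * δ := by
      refine ⟨δ / (C + δ) ^ 2, by positivity, ?_⟩
      rw [div_mul_cancel₀ _ (by positivity)]
      linarith
    have hpc0 : p - c ≠ 0 := norm_pos_iff.1 (hpc ▸ hr)
    have hf := hg.const_add_mul (p - (p - c) * ε * δ) (-((p - c) * ε))
    -- `|1 - ε (g + δ)| ^ 2 = 1 - 2 ε Re (g + δ) + ε ^ 2 |g + δ| ^ 2 < 1` by the choice of `ε`.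
    have hmaps : MapsTo (fun s => p - (p - c) * ε * δ + -((p - c) * ε) * g s) rightHalfPlane G := by
      intro s hs
      apply hball
      rw [mem_ball_iff_norm]
      have e : p - (p - c) * ε * δ + -((p - c) * ε) * g s - c = (p - c) * (1 - ε * (g s + δ)) := by
        ring
      rw [e, norm_mul, hpc]
      refine mul_lt_of_lt_one_right hr ?_
      rw [← sq_lt_one_iff₀ (norm_nonneg _), ← Complex.normSq_eq_norm_sq]
      have h1 : ‖g s + δ‖ ^ 2 ≤ (C + δ) ^ 2 := by
        gcongr
        refine (norm_add_le _ _).trans ?_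
        rw [Complex.norm_real, Real.norm_of_nonneg hδ.le]
        gcongr
        exact hC s hs
      rw [← Complex.normSq_eq_norm_sq] at h1
      have h2 : Complex.normSq (1 - ε * (g s + δ)) =
          1 - 2 * ε * ((g s).re + δ) + ε ^ 2 * Complex.normSq (g s + δ) := by
        simp [Complex.normSq_apply]; ring
      rw [h2]
      have h3 := hpos s hs
      have h4 : ε ^ 2 * Complex.normSq (g s + δ) ≤ ε * (ε * (C + δ) ^ 2) := by
        rw [← mul_assoc, ← sq]; gcongr
      have h5 : ε * (ε * (C + δ) ^ 2) < ε * (2 * δ) := by gcongr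
      nlinarith [mul_pos hε h3]
    obtain ⟨hs, hlt⟩ := hσ.2 _ _ hf hmaps
    have hc : 0 < r * ε := by positivity
    have hn : ∀ n : ℕ, ‖(if n + 2 = 1 then p - (p - c) * ε * δ else 0) +
        -((p - c) * ε) * b (n + 2)‖ / ((n + 2 : ℕ) : ℝ) ^ σ =
        r * ε * (‖b (n + 2)‖ / ((n + 2 : ℕ) : ℝ) ^ σ) := by
      intro n
      rw [if_neg (by omega), zero_add, norm_mul, norm_neg, norm_mul, hpc, Complex.norm_real,
        Real.norm_of_nonneg hε.le, mul_div_assoc]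
    simp only [hn] at hs hlt
    rw [tsum_mul_left] at hlt
    refine ⟨(summable_mul_left_iff hc.ne').1 hs, ?_⟩
    have h6 : Metric.infDist ((if 1 = 1 then p - (p - c) * ε * δ else 0) + -((p - c) * ε) * b 1)
        (frontier (convexHull ℝ G)) ≤ r * ε * (‖b 1‖ + δ) := by
      refine (Metric.infDist_le_dist_of_mem hpK).trans ?_
      rw [if_pos rfl, dist_eq_norm]
      have e : p - (p - c) * ε * δ + -((p - c) * ε) * b 1 - p = -((p - c) * ε * (b 1 + δ)) := by
        ring
      rw [e, norm_neg, norm_mul, norm_mul, hpc, Complex.norm_real, Real.norm_of_nonneg hε.le]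
      gcongr
      refine (norm_add_le _ _).trans ?_
      rw [Complex.norm_real, Real.norm_of_nonneg hδ.le]
    exact le_of_mul_le_mul_left (hlt.le.trans h6) hc
  exact ⟨(key 1 one_pos).1, le_of_forall_pos_le_add fun δ hδ => (key δ hδ).2⟩

/-- Apply the bound to `w (p - f)`, where `p` is a point of the boundary of the convex hull nearest
to `a 1` and `z ↦ Re (w z)` defines a supporting line at `p`. -/
theorem PositiveRealPartBound.mem_bohrAdmissible {G : Set ℂ} (hopen : IsOpen G)
    (hne : G.Nonempty) (hbdd : Bornology.IsBounded G) {σ τ : ℝ} (hσ : PositiveRealPartBound σ)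
    (hσ0 : 0 ≤ σ) (hστ : σ < τ) : τ ∈ bohrAdmissible G := by
  refine ⟨hσ0.trans hστ.le, fun f a hf hmaps => ?_⟩
  set K := convexHull ℝ G
  have hKo : IsOpen K := hopen.convexHull
  have hKb : Bornology.IsBounded K := isBounded_convexHull.2 hbdd
  have hfr : IsCompact (frontier K) :=
    Metric.isCompact_of_isClosed_isBounded isClosed_frontier
      (hKb.closure.subset frontier_subset_closure)
  have hfrne : (frontier K).Nonempty := by
    refine nonempty_frontier_iff.2 ⟨hne.convexHull, ?_⟩
    rintro h
    exact NormedSpace.unbounded_univ ℝ ℂ (h ▸ hKb)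
  obtain ⟨p, hp, hpd⟩ := hfr.exists_infDist_eq_dist hfrne (a 1)
  have hpK : p ∉ K := by
    rw [hKo.frontier_eq] at hp
    exact hp.2
  obtain ⟨φ, hφ⟩ := geometric_hahn_banach_open_point (convex_convexHull ℝ G) hKo hpK
  obtain ⟨w, hw⟩ : ∃ w : ℂ, ∀ z, φ z = (w * z).re := by
    refine ⟨φ 1 - φ Complex.I * Complex.I, fun z => ?_⟩
    have : z = z.re • (1 : ℂ) + z.im • Complex.I := by simp [Complex.re_add_im]
    conv_lhs => rw [this]
    simp only [map_add, map_smul, smul_eq_mul]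
    simp
    ring
  have hw0 : 0 < ‖w‖ := by
    obtain ⟨x, hx⟩ := hne
    have h := hφ x (subset_convexHull ℝ G hx)
    refine norm_pos_iff.2 fun h0 => ?_
    simp [hw, h0] at h
  have hg := hf.const_add_mul (w * p) (-w)
  have hpos : ∀ s ∈ rightHalfPlane, 0 < (w * p + -w * f s).re := by
    intro s hs
    have h := hφ _ (subset_convexHull ℝ G (hmaps hs))
    rw [hw, hw] at h
    rw [neg_mul, Complex.add_re, Complex.neg_re]
    linarith
  obtain ⟨hs, hle⟩ := hσ _ _ hg hpos
  have hn : ∀ n : ℕ, ‖(if n + 2 = 1 then w * p else 0) + -w * a (n + 2)‖ /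
      ((n + 2 : ℕ) : ℝ) ^ σ = ‖w‖ * (‖a (n + 2)‖ / ((n + 2 : ℕ) : ℝ) ^ σ) := by
    intro n
    rw [if_neg (by omega), zero_add, norm_mul, norm_neg, mul_div_assoc]
  simp only [hn] at hs hle
  rw [summable_mul_left_iff hw0.ne'] at hs
  have h1 : ‖(if True then w * p else 0) + -w * a 1‖ =
      ‖w‖ * Metric.infDist (a 1) (frontier K) := by
    rw [if_pos trivial, hpd, dist_comm, dist_eq_norm, ← norm_mul]
    congr 1
    ring
  rw [tsum_mul_left, h1] at hle
  replace hle := le_of_mul_le_mul_left hle hw0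
  have hterm : ∀ n : ℕ, ‖a (n + 2)‖ / ((n + 2 : ℕ) : ℝ) ^ τ ≤
      ‖a (n + 2)‖ / ((n + 2 : ℕ) : ℝ) ^ σ := by
    intro n
    gcongr
    exact_mod_cast (by omega : 1 ≤ n + 2)
  have hs' : Summable fun n : ℕ => ‖a (n + 2)‖ / ((n + 2 : ℕ) : ℝ) ^ τ :=
    hs.of_nonneg_of_le (fun n => by positivity) hterm
  refine ⟨hs', ?_⟩
  -- Strictness: either some coefficient with `n ≥ 2` survives and its term drops strictly from `σ`
  -- to `τ`, or `f` is the constant `a 1`, which then lies in the open hull.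
  by_cases hall : ∀ n : ℕ, a (n + 2) = 0
  · simp only [hall, norm_zero, zero_div, tsum_zero]
    have hf1 : f 1 = a 1 := by
      refine tendsto_nhds_unique (hf.tendsto 1 (by simp [rightHalfPlane])) ?_
      refine tendsto_const_nhds.congr' ?_
      filter_upwards [eventually_ge_atTop 1] with N hN
      rw [Finset.sum_eq_single_of_mem 1 (by simp [hN])]
      · simp
      · intro n hn hn1
        obtain ⟨k, rfl⟩ : ∃ k, n = k + 2 := ⟨n - 2, by have := (Finset.mem_Icc.1 hn).1; omega⟩
        simp [hall]
    rw [hpd, dist_pos]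
    rintro h
    apply hpK
    rw [← h, ← hf1]
    exact subset_convexHull ℝ G (hmaps (by simp [rightHalfPlane]))
  · push Not at hall
    obtain ⟨n, hn⟩ := hall
    refine (Summable.tsum_lt_tsum (i := n) hterm ?_ hs' hs).trans_le hle
    refine div_lt_div_of_pos_left (norm_pos_iff.2 hn) (by positivity) ?_
    exact Real.rpow_lt_rpow_of_exponent_lt (by exact_mod_cast (by omega : 1 < n + 2)) hστ

/-! ### Comparison of abscissas -/

theorem isRegularPointOfConvexity_ball :
    IsRegularPointOfConvexity (Metric.ball (0 : ℂ) 1) 1 := by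
  have h : (1 : ℂ) ∈ frontier (Metric.ball (0 : ℂ) 1) := by
    rw [frontier_ball _ one_ne_zero]; simp
  refine ⟨⟨h, ?_⟩, 0, 1, one_pos, subset_rfl, h⟩
  rwa [(convex_ball (0 : ℂ) 1).convexHull_eq]

theorem isometricBohrAbscissa_le {G G' : Set ℂ} {p : ℂ} (hp : IsRegularPointOfConvexity G p)
    (hG : (bohrAdmissible G).Nonempty) (hopen : IsOpen G') (hne : G'.Nonempty)
    (hbdd : Bornology.IsBounded G') :
    isometricBohrAbscissa G' ≤ isometricBohrAbscissa G := by
  refine le_csInf hG fun σ hσ => le_of_forall_gt_imp_ge_of_dense fun τ hτ => ?_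
  refine csInf_le ⟨0, fun x hx => hx.1⟩ ?_
  exact (positiveRealPartBound_of_mem_bohrAdmissible hp hσ).mem_bohrAdmissible
    hopen hne hbdd hσ.1 hτ

theorem theorem2p1 (G : Set ℂ) (hopen : IsOpen G) (hconn : IsConnected G)
    (hbdd : Bornology.IsBounded G) :
    (bohrAdmissible G).Nonempty ∧
    isometricBohrAbscissa G ≤ isometricBohrAbscissa (Metric.ball (0 : ℂ) 1) ∧
    ((∃ p : ℂ, IsRegularPointOfConvexity G p) →
      isometricBohrAbscissa G = isometricBohrAbscissa (Metric.ball (0 : ℂ) 1)) := by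
  have hnonempty : ∀ {D : Set ℂ}, IsOpen D → D.Nonempty → Bornology.IsBounded D →
      (bohrAdmissible D).Nonempty := fun hD hne hb =>
    ⟨8, positiveRealPartBound_seven.mem_bohrAdmissible hD hne hb (by norm_num) (by norm_num)⟩
  have hball : (Metric.ball (0 : ℂ) 1).Nonempty := ⟨0, by simp⟩
  have hle := isometricBohrAbscissa_le isRegularPointOfConvexity_ball
    (hnonempty Metric.isOpen_ball hball Metric.isBounded_ball) hopen hconn.nonempty hbdd
  refine ⟨hnonempty hopen hconn.nonempty hbdd, hle, fun ⟨p, hp⟩ => hle.antisymm ?_⟩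
  exact isometricBohrAbscissa_le hp (hnonempty hopen hconn.nonempty hbdd) Metric.isOpen_ball hball
    Metric.isBounded_ball
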